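/- Consider asynchronous oriented rings of $n\ge 1$ processes $p_0,\dots,p_{n-1}$ with pairwise distinct identifiers in $\mathbb{N}$, in which each process can send messages to its clockwise neighbour $p_{j+1}$ and to its counter-clockwise neighbour $p_{j-1}$ (indices modulo $n$). Messages carry no content, are never lost, and are delivered one by one after arbitrary finite delays chosen by an adversarial scheduler. A uniform algorithm is a deterministic event-driven algorithm that does not know $n$: the initial state of a process and the numbers of messages it first sends in each direction depend only on its identifier, and at each receipt its new state and the numbers of messages it sends in each direction depend only on its current state and on the direction in which the received message travels. It is a leader election algorithm if, for every $n\ge1$, every assignment of distinct identifiers and every execution, every process eventually enters one of the final states Leader or Non-Leader (after which it neither changes its state nor sends messages), and exactly one process enters Leader. Theorem. For every uniform leader election algorithm on content-oblivious oriented rings and every bound $b\in\mathbb{N}$, there are an oriented ring with distinct identifiers and a process on it that, in every execution on this ring, sends more than $b$ messages clockwise and more than $b$ messages counter-clockwise. In particular, no uniform leader election algorithm can have every process send at most a constant number of messages in one of the two directions. -/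

import Mathlib

namespace ContentOblivious

/-- The two directions in which a message may travel on an oriented ring. -/
inductive Direction where
  | cw
  | ccw
  deriving DecidableEq

/-- The status of a process. `leader` and `nonLeader` are the two final (terminated) statuses. -/
inductive Status where
  | undecided
  | leader
  | nonLeader
  deriving DecidableEq

/-- A deterministic, uniform, content-oblivious, event-driven algorithm with identifiers in `ℕ`
and local states in `σ`.

* `init i` is the reaction of a process with identifier `i` to its initialization event:
  its first state, and the number of messages that it sends in each direction;
* `step s d` is the reaction, in state `s`, to the receipt of a message travelling in direction `d`:
  the new state, and the number of messages sent in each direction.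

Messages carry no content, so the receipt of a message conveys only the port on which it arrives,
that is, its direction of travel. The ring size is not an argument (uniformity). A process in a
final status has terminated: it never changes its state and never sends a message again. -/
structure Algorithm (σ : Type*) where
  init : ℕ → σ × (Direction → ℕ)
  step : σ → Direction → σ × (Direction → ℕ)
  status : σ → Status
  final : ∀ s d, status s ≠ Status.undecided → step s d = (s, fun _ => 0)

/-- A configuration of a ring with `n` processes, indexed by `Fin n` in clockwise order. -/
structure Config (σ : Type*) (n : ℕ) where
  /-- the local state of each process -/
  state : Fin n → σ
  /-- `inTransit i d`: number of messages travelling in direction `d` that are sent to process `i`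
  by its neighbour and not yet delivered -/
  inTransit : Fin n → Direction → ℕ
  /-- `sent i d`: number of messages that process `i` has sent in direction `d` so far -/
  sent : Fin n → Direction → ℕ

/-- The process from which process `i` receives the messages travelling in direction `d`
(indices are taken modulo `n`; for `n = 1` it is the process itself). -/
def sender {n : ℕ} [NeZero n] (i : Fin n) : Direction → Fin n
  | Direction.cw => i - 1
  | Direction.ccw => i + 1

namespace Algorithm

variable {σ : Type*} (A : Algorithm σ) {n : ℕ} [NeZero n]

/-- The configuration in which every process has performed its initialization event. -/
def initial (ids : Fin n → ℕ) : Config σ n where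
  state i := (A.init (ids i)).1
  inTransit i d := (A.init (ids (sender i d))).2 d
  sent i d := (A.init (ids i)).2 d

/-- Delivery to process `i` of one message travelling in direction `d`, and the reaction of
process `i`. If there is no such message in transit, nothing happens. -/
def deliver (c : Config σ n) (i : Fin n) (d : Direction) : Config σ n :=
  if c.inTransit i d = 0 then c
  else
    let r := A.step (c.state i) d
    { state := fun j => if j = i then r.1 else c.state j
      inTransit := fun j e =>
        (c.inTransit j e - if j = i ∧ e = d then 1 else 0) + (if sender j e = i then r.2 e else 0)
      sent := fun j e => c.sent j e + if j = i then r.2 e else 0 }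

/-- The configuration after the first `t` events of the schedule `sched`, where `sched t = (i, d)`
means that the event number `t` is the delivery to process `i` of a message travelling in
direction `d`. -/
def run (ids : Fin n → ℕ) (sched : ℕ → Fin n × Direction) : ℕ → Config σ n
  | 0 => A.initial ids
  | t + 1 => A.deliver (run ids sched t) (sched t).1 (sched t).2

/-- The schedule determines an admissible asynchronous execution: every message has a finite
(but arbitrary) delay. -/
def IsFair (ids : Fin n → ℕ) (sched : ℕ → Fin n × Direction) : Prop :=
  ∀ t i d, 0 < (A.run ids sched t).inTransit i d → ∃ t', t ≤ t' ∧ sched t' = (i, d)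

/-- On every ring there is an admissible execution. -/
theorem exists_isFair (ids : Fin n → ℕ) : ∃ sched, A.IsFair ids sched := by
  have hc : Countable (ℕ × Fin n × Direction) := by
    have : Countable Direction :=
      Function.Injective.countable (f := fun d : Direction => decide (d = Direction.cw))
        (by intro a b; cases a <;> cases b <;> simp)
    infer_instance
  have : Nonempty (ℕ × Fin n × Direction) := ⟨(0, 0, Direction.cw)⟩
  obtain ⟨f, hf⟩ := exists_surjective_nat (ℕ × Fin n × Direction)
  refine ⟨fun t => (f t).2, fun t i d _ => ?_⟩
  by_contra! h
  have hinf : (Set.range fun m : ℕ => (m, i, d)).Infinite :=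
    Set.infinite_range_of_injective fun a b hab => congrArg Prod.fst hab
  refine hinf (((Set.finite_lt_nat t).image f).subset ?_)
  rintro _ ⟨m, rfl⟩
  obtain ⟨s, hs⟩ := hf (m, i, d)
  refine ⟨s, ?_, hs⟩
  by_contra hst
  exact h s (not_lt.mp hst) (by simp [hs])

/-- The algorithm solves terminating leader election on all oriented rings: for every ring size
`n ≥ 1`, every assignment of distinct identifiers and every admissible execution, all processes
eventually are in a final status, exactly one of them being the leader. -/
def ElectsLeader : Prop :=
  ∀ (n : ℕ) [NeZero n] (ids : Fin n → ℕ), Function.Injective ids →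
    ∀ sched : ℕ → Fin n × Direction, A.IsFair ids sched →
      ∃ t, (∀ i, A.status ((A.run ids sched t).state i) ≠ Status.undecided) ∧
        ∃! i, A.status ((A.run ids sched t).state i) = Status.leader

end Algorithm

end ContentOblivious

/-!
# Both directions carry unboundedly many messages

The ring with the required property can be taken to consist of a single process.  Suppose that,
for every identifier `i`, some execution of the one-process ring sends at most `b` messages in one
of the two directions.  By the pigeonhole principle this scarce direction `e` is the same for
infinitely many identifiers; let `d` be the other direction, and let `H i` be the sequence of
receipts after which the solitary process `i` is a leader.  Being solitary, the process has sent,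
before each of these receipts, more messages in the direction of the receipt than it has received
(`Solitary`).

For `j ≤ b` let `profile d e (H i) j` be the number of `d`-receipts in `H i` before the receipt
number `j + 1` from direction `e`.  By Dickson's lemma there is a sequence of identifiers along
which every `profile d e (H i) j` is monotone.  Put these identifiers on a ring in that order, so
that `d`-messages travel from higher to lower ranks, and consider a maximal execution prefix in
which every process has only seen a part of its solitary history (`exists_maximal_histories`).  A
process that has not completed its history then waits for a message of direction `d` or `e`, and

* a process waiting for `e` cannot follow, in the order of ranks, one waiting for `d`, by
  monotonicity of the profiles;
* along consecutive processes waiting for `e`, the number of `e`-receipts increases strictly with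
  the rank, so there are at most `b + 1` of them;
* along consecutive processes waiting for `d`, the number of `d`-receipts increases strictly as the
  rank decreases, and at the lowest rank it is bounded by the profile.

Hence every sufficiently long stretch of ranks contains a process that has completed its solitary
history (`exists_complete_of_blocked`), and is a leader.  Two disjoint stretches give two leaders
on one ring.
-/

namespace ContentOblivious

/-! ### Lists of receipts -/

/-- The largest number of occurrences of `d` in a suffix of `H` that contains at most `j`
occurrences of `e`.  Histories are written with the newest receipt first, so the suffixes of `H`
are the earlier histories. -/
def profile (d e : Direction) (H : List Direction) (j : ℕ) : ℕ :=
  (H.tails.toFinset.filter fun h => h.count e ≤ j).sup fun h => h.count d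

theorem count_le_profile {d e : Direction} {H h : List Direction} {j : ℕ} (hs : h <:+ H)
    (hj : h.count e ≤ j) : h.count d ≤ profile d e H j :=
  Finset.le_sup (f := fun h : List Direction => h.count d) (by simp [hs, hj])

theorem profile_mono (d e : Direction) (H : List Direction) : Monotone (profile d e H) := by
  intro j k hjk
  refine Finset.sup_mono fun h => ?_
  simp only [Finset.mem_filter]
  exact fun hh => ⟨hh.1, hh.2.trans hjk⟩

/-- Just before a receipt of direction `e`, the profile is attained. -/
theorem profile_le_count {d e : Direction} {H h : List Direction} (hs : (e :: h) <:+ H) :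
    profile d e H (h.count e) ≤ h.count d := by
  refine Finset.sup_le fun h' hh' => ?_
  simp only [Finset.mem_filter, List.mem_toFinset, List.mem_tails] at hh'
  obtain ⟨hs', hc⟩ := hh'
  rcases List.suffix_or_suffix_of_suffix hs hs' with h1 | h1
  · have := h1.sublist.count_le e
    simp at this
    omega
  · rcases List.suffix_cons_iff.1 h1 with rfl | h2
    · simp at hc
    · exact h2.sublist.count_le d

theorem exists_cons_suffix {H h : List Direction} (hs : h <:+ H) (hne : h ≠ H) :
    ∃ x, (x :: h) <:+ H := by
  obtain ⟨l, rfl⟩ := hs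
  rcases l.eq_nil_or_concat with rfl | ⟨l', x, rfl⟩
  · simp at hne
  · exact ⟨x, l', by simp⟩

/-- The direction opposite to a given one. -/
def Direction.opposite : Direction → Direction
  | Direction.cw => Direction.ccw
  | Direction.ccw => Direction.cw

theorem Direction.opposite_ne (e : Direction) : e.opposite ≠ e := by
  cases e <;> simp [Direction.opposite]

theorem Direction.eq_or_eq {d e : Direction} (hde : d ≠ e) (x : Direction) : x = d ∨ x = e := by
  revert hde; cases d <;> cases e <;> cases x <;> simp

theorem Direction.finite : Finite Direction :=
  Finite.of_injective (fun d : Direction => decide (d = Direction.cw))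
    (by intro a b; cases a <;> cases b <;> simp)

namespace Algorithm

variable {σ : Type*} (A : Algorithm σ) {n : ℕ} [NeZero n]

/-! ### Local histories -/

/-- The state of a process with identifier `i` whose receipts so far are the list `h`, newest
first, together with the number of messages that it has sent in each direction. -/
def play (i : ℕ) : List Direction → σ × (Direction → ℕ)
  | [] => A.init i
  | d :: h => ((A.step (play i h).1 d).1, fun e => (play i h).2 e + (A.step (play i h).1 d).2 e)

/-- The receipts of each process during the first `t` events of a schedule, newest first. -/
def hist (ids : Fin n → ℕ) (sched : ℕ → Fin n × Direction) : ℕ → Fin n → List Direction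
  | 0, _ => []
  | t + 1, i =>
    if i = (sched t).1 ∧ (A.run ids sched t).inTransit (sched t).1 (sched t).2 ≠ 0 then
      (sched t).2 :: hist ids sched t i
    else hist ids sched t i

/-- The local states, the numbers of sent messages and the messages in transit are all functions
of the local histories. -/
theorem run_eq_play (ids : Fin n → ℕ) (sched : ℕ → Fin n × Direction) (t : ℕ) :
    (∀ i, (A.run ids sched t).state i = (A.play (ids i) (A.hist ids sched t i)).1) ∧
    (∀ i d, (A.run ids sched t).sent i d = (A.play (ids i) (A.hist ids sched t i)).2 d) ∧
    (∀ i d, (A.run ids sched t).inTransit i d + (A.hist ids sched t i).count d =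
      (A.play (ids (sender i d)) (A.hist ids sched t (sender i d))).2 d) := by
  induction t with
  | zero => simp [run, hist, initial, play]
  | succ t ih =>
    obtain ⟨h1, h2, h3⟩ := ih
    by_cases h0 : (A.run ids sched t).inTransit (sched t).1 (sched t).2 = 0
    · have hr : A.run ids sched (t + 1) = A.run ids sched t := by simp [run, deliver, h0]
      have hh : ∀ i, A.hist ids sched (t + 1) i = A.hist ids sched t i := by
        intro i; simp [hist, h0]
      simp only [hr, hh]
      exact ⟨h1, h2, h3⟩
    · generalize hj : (sched t).1 = j at h0
      generalize hx : (sched t).2 = x at h0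
      have hh : ∀ i, A.hist ids sched (t + 1) i =
          if i = j then x :: A.hist ids sched t i else A.hist ids sched t i := by
        intro i; simp [hist, hj, hx, h0]
      have hp : ∀ i d, (A.play (ids i) (A.hist ids sched (t + 1) i)).2 d =
          (A.play (ids i) (A.hist ids sched t i)).2 d +
            if i = j then (A.step ((A.run ids sched t).state j) x).2 d else 0 := by
        intro i d
        rw [hh]
        split_ifs with hij
        · subst hij; simp [play, h1]
        · simp
      refine ⟨fun i => ?_, fun i d => ?_, fun i d => ?_⟩
      · rw [hh]
        simp only [run, deliver, hj, hx, h0, if_false]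
        split_ifs with hij
        · subst hij; simp [play, h1]
        · exact h1 i
      · rw [hp, ← h2]
        simp [run, deliver, hj, hx, h0]
      · rw [hp, ← h3, hh]
        simp only [run, deliver, hj, hx, h0, if_false]
        by_cases hij : i = j
        · subst hij
          by_cases hdx : d = x
          · subst hdx
            simp only [and_self, if_true, List.count_cons_self]
            omega
          · simp only [hdx, and_false, if_false, if_true, List.count_cons_of_ne (Ne.symm hdx)]
            omega
        · simp only [hij, false_and, if_false]
          omega

theorem play_sent_mono (i : ℕ) {h H : List Direction} (hs : h <:+ H) (d : Direction) :
    (A.play i h).2 d ≤ (A.play i H).2 d := by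
  induction H with
  | nil => simp [List.suffix_nil.1 hs]
  | cons x H ih =>
    rcases List.suffix_cons_iff.1 hs with rfl | h2
    · exact le_rfl
    · exact (ih h2).trans (Nat.le_add_right _ _)

/-- In a final status the local state is frozen. -/
theorem play_eq_of_final (i : ℕ) {h H : List Direction} (hs : h <:+ H)
    (hf : A.status (A.play i h).1 ≠ Status.undecided) : (A.play i H).1 = (A.play i h).1 := by
  induction H with
  | nil => simp [List.suffix_nil.1 hs]
  | cons x H ih =>
    rcases List.suffix_cons_iff.1 hs with rfl | h2
    · rfl
    · have := ih h2
      simp only [play]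
      rw [A.final _ _ (by rwa [this]), this]

theorem hist_suffix (ids : Fin n → ℕ) (sched : ℕ → Fin n × Direction) {s t : ℕ} (hst : s ≤ t)
    (i : Fin n) : A.hist ids sched s i <:+ A.hist ids sched t i := by
  induction t, hst using Nat.le_induction with
  | base => exact List.suffix_refl _
  | succ t _ ih =>
    refine ih.trans ?_
    simp only [hist]
    split_ifs
    · exact List.suffix_cons _ _
    · exact List.suffix_refl _

theorem state_eq_of_final (ids : Fin n → ℕ) (sched : ℕ → Fin n × Direction) {s t : ℕ}
    (hst : s ≤ t) (i : Fin n)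
    (hf : A.status ((A.run ids sched s).state i) ≠ Status.undecided) :
    (A.run ids sched t).state i = (A.run ids sched s).state i := by
  rw [(A.run_eq_play ids sched s).1] at hf ⊢
  rw [(A.run_eq_play ids sched t).1]
  exact A.play_eq_of_final _ (A.hist_suffix ids sched hst i) hf

/-! ### Schedules with a prescribed beginning -/

theorem run_hist_congr (ids : Fin n → ℕ) {s s' : ℕ → Fin n × Direction} {T : ℕ}
    (h : ∀ t < T, s t = s' t) :
    A.run ids s T = A.run ids s' T ∧ A.hist ids s T = A.hist ids s' T := by
  induction T with
  | zero => exact ⟨rfl, rfl⟩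
  | succ T ih =>
    obtain ⟨h1, h2⟩ := ih fun t ht => h t (ht.trans T.lt_succ_self)
    refine ⟨?_, ?_⟩
    · simp only [run, h1, h T T.lt_succ_self]
    · funext i
      simp only [hist, h1, h2, h T T.lt_succ_self]

theorem exists_isFair_extending (ids : Fin n → ℕ) (sched : ℕ → Fin n × Direction) (T : ℕ) :
    ∃ sched', A.IsFair ids sched' ∧ ∀ t < T, sched t = sched' t := by
  have := Direction.finite
  have : Nonempty (ℕ × Fin n × Direction) := ⟨(0, 0, Direction.cw)⟩
  obtain ⟨f, hf⟩ := exists_surjective_nat (ℕ × Fin n × Direction)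
  refine ⟨fun t => if t < T then sched t else (f t).2, fun t i d _ => ?_, fun t ht => by simp [ht]⟩
  -- the event `(i, d)` is named infinitely often by `f`, hence also after time `max t T`
  have hinf : (f ⁻¹' Set.range fun m : ℕ => (m, i, d)).Infinite :=
    Set.Infinite.preimage
      (Set.infinite_range_of_injective fun a b hab => congrArg Prod.fst hab)
      (by simp [hf.range_eq])
  obtain ⟨s, ⟨m, hm⟩, hs⟩ := hinf.exists_gt (max t T)
  refine ⟨s, by omega, ?_⟩
  simp only [if_neg (show ¬ s < T by omega), ← hm]

/-- No execution prefix of a leader election algorithm contains two leaders. -/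
theorem ElectsLeader.eq_of_leader {A : Algorithm σ} (hA : A.ElectsLeader) {ids : Fin n → ℕ}
    (hids : Function.Injective ids) (sched : ℕ → Fin n × Direction) (T : ℕ) {i j : Fin n}
    (hi : A.status ((A.run ids sched T).state i) = Status.leader)
    (hj : A.status ((A.run ids sched T).state j) = Status.leader) : i = j := by
  obtain ⟨s, hs, hag⟩ := A.exists_isFair_extending ids sched T
  rw [(A.run_hist_congr ids hag).1] at hi hj
  obtain ⟨t, hfin, hl⟩ := hA n ids hids s hs
  have key : ∀ k, A.status ((A.run ids s T).state k) = Status.leader →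
      A.status ((A.run ids s t).state k) = Status.leader := by
    intro k hk
    rw [← A.state_eq_of_final ids s (le_max_left t T) k (hfin k),
      A.state_eq_of_final ids s (le_max_right t T) k (by simp [hk]), hk]
  exact hl.unique (key i hi) (key j hj)

/-! ### Solitary processes -/

/-- `H` is a possible history of the process with identifier `i` on the one-process ring: each
receipt was preceded by the sending of the message received. -/
def Solitary (i : ℕ) (H : List Direction) : Prop :=
  ∀ d h, (d :: h) <:+ H → h.count d < (A.play i h).2 d

variable {A} in
theorem Solitary.count_le {i : ℕ} {H h : List Direction} (hH : A.Solitary i H) (hs : h <:+ H)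
    (d : Direction) : h.count d ≤ (A.play i h).2 d := by
  induction h with
  | nil => simp
  | cons x h ih =>
    have hm := A.play_sent_mono i (List.suffix_cons x h) d
    by_cases hx : x = d
    · subst hx
      have := hH x h hs
      simp only [List.count_cons_self]
      omega
    · rw [List.count_cons_of_ne hx]
      exact (ih ((List.suffix_cons x h).trans hs)).trans hm

theorem solitary_hist (ids : Fin 1 → ℕ) (sched : ℕ → Fin 1 × Direction) (t : ℕ) :
    A.Solitary (ids 0) (A.hist ids sched t 0) := by
  induction t with
  | zero => intro d h hs; simp [hist] at hs
  | succ t ih =>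
    simp only [hist]
    split_ifs with hc
    · intro d h hs
      rcases List.suffix_cons_iff.1 hs with heq | hs
      · obtain ⟨rfl, rfl⟩ := List.cons.inj heq
        have h3 := (A.run_eq_play ids sched t).2.2 (sched t).1 (sched t).2
        rw [Subsingleton.elim (sender _ _) (0 : Fin 1)] at h3
        rw [← hc.1] at h3
        have := hc.2
        rw [← hc.1] at this
        omega
      · exact ih d h hs
    · exact ih

/-- If on the one-process ring the process does not send more than `b` messages in both
directions, then it becomes a leader with one direction carrying at most `b` messages. -/
theorem ElectsLeader.exists_solitary {A : Algorithm σ} (hA : A.ElectsLeader) {b i : ℕ}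
    {sched : ℕ → Fin 1 × Direction} (hf : A.IsFair (fun _ => i) sched)
    (hb : ∀ t, ∃ d, (A.run (fun _ => i) sched t).sent 0 d ≤ b) :
    ∃ e H, A.Solitary i H ∧ (A.play i H).2 e ≤ b ∧ A.status (A.play i H).1 = Status.leader := by
  obtain ⟨t, -, k, hk, -⟩ := hA 1 (fun _ => i) (Function.injective_of_subsingleton _) sched hf
  obtain ⟨e, he⟩ := hb t
  have hr := A.run_eq_play (fun _ => i) sched t
  refine ⟨e, A.hist (fun _ => i) sched t 0, A.solitary_hist (fun _ => i) sched t, ?_, ?_⟩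
  · rwa [← hr.2.1]
  · rw [← hr.1, ← Subsingleton.elim k (0 : Fin 1)]
    exact hk

/-! ### Maximal execution prefixes along solitary histories -/

/-- Given a target history for each process, there is an execution prefix along these targets that
cannot be extended: no process has in transit a message that its target history allows next. -/
theorem exists_maximal_histories (ids : Fin n → ℕ) (H : Fin n → List Direction) :
    ∃ sched T, (∀ i, A.hist ids sched T i <:+ H i) ∧
      ∀ i d, (d :: A.hist ids sched T i) <:+ H i →
        (A.play (ids (sender i d)) (A.hist ids sched T (sender i d))).2 d ≤
          (A.hist ids sched T i).count d := by
  let S : Set ℕ := {m | ∃ sched T, (∀ i, A.hist ids sched T i <:+ H i) ∧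
    ∑ i, (A.hist ids sched T i).length = m}
  have hne : S.Nonempty :=
    ⟨0, fun _ => (0, Direction.cw), 0, fun i => by simp [hist], by simp [hist]⟩
  have hbdd : BddAbove S := by
    refine ⟨∑ i, (H i).length, ?_⟩
    rintro _ ⟨sched, T, h, rfl⟩
    exact Finset.sum_le_sum fun i _ => (h i).length_le
  obtain ⟨sched, T, hs, hm⟩ := Nat.sSup_mem hne hbdd
  refine ⟨sched, T, hs, fun i d hd => ?_⟩
  rw [← (A.run_eq_play ids sched T).2.2 i d]
  suffices h0 : (A.run ids sched T).inTransit i d = 0 by omega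
  by_contra h0
  -- delivering the message would give a longer execution prefix along the targets
  let s' := Function.update sched T (i, d)
  have hag : ∀ t < T, sched t = s' t := fun t ht => by
    simp [s', Function.update_of_ne ht.ne]
  obtain ⟨hr, hh⟩ := A.run_hist_congr ids hag
  have hT : s' T = (i, d) := by simp [s']
  have hn : ∀ k, A.hist ids s' (T + 1) k =
      if k = i then d :: A.hist ids sched T k else A.hist ids sched T k := by
    intro k; simp [hist, ← hr, ← hh, hT, h0]
  have hmem : ∑ k, (A.hist ids s' (T + 1) k).length ∈ S := by
    refine ⟨s', T + 1, fun k => ?_, rfl⟩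
    rw [hn]
    split_ifs with hk
    · subst hk; exact hd
    · exact hs k
  have hlt : ∑ k, (A.hist ids sched T k).length < ∑ k, (A.hist ids s' (T + 1) k).length := by
    refine Finset.sum_lt_sum (fun k _ => ?_) ⟨i, Finset.mem_univ _, by simp [hn]⟩
    rw [hn]
    split_ifs <;> simp
  have := le_csSup hbdd hmem
  omega

/-- In a long stretch of ranks, processes that follow solitary histories with at most `b` messages
in direction `e` and monotone profiles cannot all be blocked. Here `d`-messages travel from rank
`r + 1` to rank `r`, and `e`-messages from rank `r` to rank `r + 1`. -/
theorem exists_complete_of_blocked {d e : Direction} (hde : d ≠ e) {b s top : ℕ}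
    {g : ℕ → ℕ} {H h : ℕ → List Direction} (hsol : ∀ r, A.Solitary (g r) (H r))
    (hb : ∀ r, (A.play (g r) (H r)).2 e ≤ b)
    (hmono : ∀ j ≤ b, Monotone fun r => profile d e (H r) j)
    (hsuf : ∀ r, r < top → h r <:+ H r)
    (hd : ∀ r, r + 1 < top → (d :: h r) <:+ H r →
      (A.play (g (r + 1)) (h (r + 1))).2 d ≤ (h r).count d)
    (he : ∀ r, r + 1 < top → (e :: h (r + 1)) <:+ H (r + 1) →
      (A.play (g r) (h r)).2 e ≤ (h (r + 1)).count e)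
    (htop : s + b + 1 + profile d e (H (s + b + 1)) b + 1 < top) :
    ∃ r, s ≤ r ∧ r < top ∧ h r = H r := by
  by_contra! hne
  have hnext : ∀ r, s ≤ r → r < top → (d :: h r) <:+ H r ∨ (e :: h r) <:+ H r := by
    intro r hr hr'
    obtain ⟨x, hx⟩ := exists_cons_suffix (hsuf r hr') (hne r hr hr')
    rcases Direction.eq_or_eq hde x with rfl | rfl
    · exact Or.inl hx
    · exact Or.inr hx
  have hcount : ∀ r, r < top → (h r).count e ≤ b := fun r hr =>
    ((hsol r).count_le (hsuf r hr) e).trans ((A.play_sent_mono _ (hsuf r hr) e).trans (hb r))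
  -- waiting for `d` propagates to higher ranks
  have hup : ∀ r, s ≤ r → r + 1 < top → (d :: h r) <:+ H r →
      (d :: h (r + 1)) <:+ H (r + 1) := by
    intro r hr hr' hdr
    refine (hnext (r + 1) (by omega) hr').resolve_right fun her => ?_
    have h1 := hd r hr' hdr
    have h2 := he r hr' her
    have h3 := (hsol (r + 1)).count_le (hsuf _ hr') d
    have h4 := (hsol r).count_le (hsuf r (by omega)) e
    have h5 := profile_le_count (d := d) her
    have h6 : profile d e (H r) ((h (r + 1)).count e) ≤
        profile d e (H (r + 1)) ((h (r + 1)).count e) :=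
      hmono _ (hcount _ hr') r.le_succ
    have h7 : (d :: h r).count d ≤ profile d e (H r) ((d :: h r).count e) :=
      count_le_profile hdr le_rfl
    rw [List.count_cons_of_ne hde, List.count_cons_self] at h7
    have h8 := profile_mono d e (H r) (h4.trans h2)
    omega
  have hfirst : (d :: h (s + b + 1)) <:+ H (s + b + 1) := by
    refine (hnext (s + b + 1) (by omega) (by omega)).resolve_right fun her => ?_
    have hall : ∀ k ≤ b + 1, ¬ (d :: h (s + k)) <:+ H (s + k) →
        (e :: h (s + k)) <:+ H (s + k) ∧ k ≤ (h (s + k)).count e := by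
      intro k
      induction k with
      | zero => exact fun _ hnd => ⟨(hnext s le_rfl (by omega)).resolve_left hnd, Nat.zero_le _⟩
      | succ k ih =>
        intro hk hnd
        have hE := (hnext (s + (k + 1)) (by omega) (by omega)).resolve_left hnd
        obtain ⟨h1, h2⟩ := ih (by omega) fun hD => hnd (hup (s + k) (by omega) (by omega) hD)
        have h3 := he (s + k) (by omega) hE
        have h4 := hsol _ _ _ h1
        exact ⟨hE, by rw [← add_assoc]; omega⟩
    have hD : ¬ (d :: h (s + b + 1)) <:+ H (s + b + 1) := fun hD => by
      rcases List.suffix_or_suffix_of_suffix hD her with hx | hx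
      · exact hde (List.cons.inj (hx.eq_of_length (by simp))).1
      · exact hde (List.cons.inj (hx.eq_of_length (by simp))).1.symm
    have h1 := (hall (b + 1) le_rfl hD).2
    have h2 := hcount (s + b + 1) (by omega)
    rw [← add_assoc] at h1
    omega
  have hrest : ∀ k, s + b + 1 + k < top → (d :: h (s + b + 1 + k)) <:+ H (s + b + 1 + k) := by
    intro k
    induction k with
    | zero => exact fun _ => hfirst
    | succ k ih => exact fun hk => hup (s + b + 1 + k) (by omega) hk (ih (by omega))
  have hdown : ∀ k, s + b + 1 + k < top →
      (h (s + b + 1 + k)).count d + k ≤ (h (s + b + 1)).count d := by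
    intro k
    induction k with
    | zero => simp
    | succ k ih =>
      intro hk
      have h1 := hd (s + b + 1 + k) hk (hrest k (by omega))
      have h2 := hsol _ _ _ (hrest (k + 1) hk)
      have h3 := ih (by omega)
      simp only [← add_assoc] at h2 ⊢
      omega
  have h1 := hdown (profile d e (H (s + b + 1)) b + 1) (by omega)
  have h2 := count_le_profile (d := d) (hsuf (s + b + 1) (by omega)) (hcount _ (by omega))
  omega

end Algorithm

/-! ### Ranks on the ring -/

/-- For each direction `e` the processes can be numbered so that `e`-messages travel from rank `r`
to rank `r + 1`, and messages of the opposite direction from rank `r + 1` to rank `r`. -/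
theorem exists_ranking (n : ℕ) [NeZero n] (e : Direction) :
    ∃ (rank : Fin n → ℕ) (pos : ℕ → Fin n), Function.Injective rank ∧
      (∀ r < n, rank (pos r) = r) ∧
      (∀ r, r + 1 < n → sender (pos r) e.opposite = pos (r + 1) ∧ sender (pos (r + 1)) e = pos r) := by
  have hsucc : ∀ r, Fin.ofNat n (r + 1) = Fin.ofNat n r + 1 := by
    intro r; ext; simp [Fin.val_add]
  cases e with
  | cw =>
    refine ⟨Fin.val, Fin.ofNat n, Fin.val_injective,
      fun r hr => by simp [Nat.mod_eq_of_lt hr], fun r _ => ⟨(hsucc r).symm, ?_⟩⟩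
    rw [hsucc]
    exact add_sub_cancel_right _ _
  | ccw =>
    have hsub : ∀ r, r + 1 < n → Fin.ofNat n (n - 1 - r) = Fin.ofNat n (n - 1 - (r + 1)) + 1 := by
      intro r hr
      rw [← hsucc]
      congr 1
      omega
    refine ⟨fun i => n - 1 - i.val, fun r => Fin.ofNat n (n - 1 - r),
      fun i j hij => ?_, fun r hr => ?_, fun r hr => ⟨?_, (hsub r hr).symm⟩⟩
    · have := i.isLt
      have := j.isLt
      ext
      simp only at hij
      omega
    · have : (n - 1 - r) % n = n - 1 - r := Nat.mod_eq_of_lt (by omega)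
      simp only [Fin.val_ofNat, this]
      omega
    · simp only [hsub r hr]
      exact add_sub_cancel_right _ _

end ContentOblivious

open ContentOblivious ContentOblivious.Algorithm in
theorem theorem1 {σ : Type*} (A : ContentOblivious.Algorithm σ) (hA : A.ElectsLeader) (b : ℕ) :
    ∃ (n : ℕ) (_ : NeZero n) (ids : Fin n → ℕ), Function.Injective ids ∧
      ∃ p : Fin n, ∀ sched : ℕ → Fin n × ContentOblivious.Direction, A.IsFair ids sched →
        ∃ t, ∀ d : ContentOblivious.Direction, b < (A.run ids sched t).sent p d := by
  by_contra! hcon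
  have hsolo : ∀ i, ∃ e H, A.Solitary i H ∧ (A.play i H).2 e ≤ b ∧
      A.status (A.play i H).1 = Status.leader := by
    intro i
    obtain ⟨sched, hf, hb⟩ :=
      hcon 1 inferInstance (fun _ => i) (Function.injective_of_subsingleton _) 0
    exact hA.exists_solitary hf hb
  choose E H hsol hb hl using hsolo
  have := Direction.finite
  obtain ⟨e, hinf⟩ := Finite.exists_infinite_fiber E
  have hinf' : (E ⁻¹' {e}).Infinite := Set.infinite_coe_iff.1 hinf
  let f : ℕ → ℕ := Nat.nth (· ∈ E ⁻¹' {e})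
  have hf : StrictMono f := Nat.nth_strictMono hinf'
  have hfe : ∀ r, E (f r) = e := fun r => Nat.nth_mem_of_infinite hinf' r
  -- Dickson's lemma
  obtain ⟨φ, hφ⟩ := (wellQuasiOrdered_le (α := Fin (b + 1) → ℕ)).exists_monotone_subseq
    fun r j => profile e.opposite e (H (f r)) j
  let g : ℕ → ℕ := fun r => f (φ r)
  have hg : Function.Injective g := hf.injective.comp φ.injective
  have hbg : ∀ r, (A.play (g r) (H (g r))).2 e ≤ b := fun r => by
    have := hb (g r)
    rwa [hfe] at this
  have hmono : ∀ j ≤ b, Monotone fun r => profile e.opposite e (H (g r)) j :=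
    fun j hj r r' hrr' => hφ r r' hrr' ⟨j, by omega⟩
  -- the bounds of two disjoint stretches of ranks, `[0, s)` and `[s, n)`
  let next : ℕ → ℕ := fun s => s + b + 1 + profile e.opposite e (H (g (s + b + 1))) b + 2
  obtain ⟨s, hs⟩ : ∃ s, s = next 0 := ⟨_, rfl⟩
  obtain ⟨n, hn⟩ : ∃ n, n = next s := ⟨_, rfl⟩
  have hsn : s < n := by simp only [hn, next]; omega
  have : NeZero n := ⟨by omega⟩
  obtain ⟨rank, pos, hrank, hrp, hsend⟩ := exists_ranking n e
  obtain ⟨sched, T, hsuf, hmax⟩ :=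
    A.exists_maximal_histories (fun i => g (rank i)) fun i => H (g (rank i))
  have hcomplete : ∀ s top, top ≤ n → top = next s →
      ∃ r, s ≤ r ∧ r < top ∧
        A.hist (fun i => g (rank i)) sched T (pos r) = H (g r) := by
    intro s top htop hst
    refine A.exists_complete_of_blocked e.opposite_ne (g := g) (H := fun r => H (g r))
      (h := fun r => A.hist (fun i => g (rank i)) sched T (pos r))
      (fun r => hsol _) hbg hmono (fun r hr => ?_) (fun r hr hd => ?_) (fun r hr he => ?_)
      (by simp only [hst, next]; omega)
    · simpa only [hrp r (by omega)] using hsuf (pos r)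
    · have := hmax (pos r) e.opposite (by simpa only [hrp r (by omega)] using hd)
      simpa only [(hsend r (by omega)).1, hrp (r + 1) (by omega)] using this
    · have := hmax (pos (r + 1)) e (by simpa only [hrp (r + 1) (by omega)] using he)
      simpa only [(hsend r (by omega)).2, hrp r (by omega)] using this
  have hleader : ∀ r < n, A.hist (fun i => g (rank i)) sched T (pos r) = H (g r) →
      A.status ((A.run (fun i => g (rank i)) sched T).state (pos r)) = Status.leader := by
    intro r hr h
    rw [(A.run_eq_play _ sched T).1, h, hrp r hr]
    exact hl (g r)
  obtain ⟨r, -, hr, hr'⟩ := hcomplete 0 s hsn.le hs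
  obtain ⟨q, hq, hqn, hq'⟩ := hcomplete s n le_rfl hn
  have heq := hA.eq_of_leader (hg.comp hrank) sched T (hleader r (by omega) hr')
    (hleader q hqn hq')
  have := congrArg rank heq
  rw [hrp r (by omega), hrp q hqn] at this
  omega
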